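/- Let $q$ be a prime power, let $0\le m\le n$, and let $V_0,V_1$ be vector spaces over $\mathbb F_q$ with $\dim V_0=m$ and $\dim V_1=n-m$. Let $H=\mathrm{GL}(V_0)\times\mathrm{GL}(V_1)$ act on the abelian group $A=\mathrm{Hom}(V_1,V_0)$ by $(g_0,g_1)T=g_0Tg_1^{-1}$. Let $W_0\le V_0$ and $W_1\le V_1$ be subspaces of dimensions $r$ and $s$, let $K$ be the stabilizer of $(W_0,W_1)$ in $H$, let $B=\mathrm{Hom}(W_1,V_0/W_0)$ with the induced action of $K$, and let $\pi\colon A\to B$ be the map $T\mapsto \pi_{W_0}T\iota_{W_1}$, where $\pi_{W_0}\colon V_0\to V_0/W_0$ is the projection and $\iota_{W_1}\colon W_1\to V_1$ the inclusion. If a group $G$ acts by automorphisms on a finite abelian group $M$ and $\psi\in\widehat M$, put ${}^g\psi(a)=\psi(g^{-1}a)$. For $\theta\in\widehat B$ let $H_\theta$ be the stabilizer in $H$ of the inflated character $\theta\circ\pi\in\widehat A$, and let $K_\theta=H_\theta\cap K$. For each $0\le\ell\le\min\{m-r,s\}$ choose a linear map $\Omega_\ell\colon V_0\to V_1$ of rank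 $\ell$ with $W_0\le\ker\Omega_\ell$ and $\mathrm{Im}\,\Omega_\ell\le W_1$. Let $H_{\Omega_\ell}=\{(g_0,g_1)\in H: g_1\Omega_\ell g_0^{-1}=\Omega_\ell\}$ and $K_{\Omega_\ell}=K\cap H_{\Omega_\ell}$. Fix a nontrivial additive character $\tau$ of $\mathbb F_q$ and define $\theta_\ell\in\widehat B$ by $\theta_\ell(\Psi)=\tau\bigl(\mathrm{Tr}[\overline\Omega_\ell\Psi]\bigr)$, where $\overline\Omega_\ell\colon V_0/W_0\to W_1$ is induced by $\Omega_\ell$. Write $\mathcal G^q_{k,j}$ for the set of $j$-dimensional subspaces of $\mathbb F_q^k$, and, for $a,b\geq 0$, let $P_{a,b}\le\mathrm{GL}(\mathbb F_q^a\oplus\mathbb F_q^b)$ be the image of $(\mathrm{GL}(\mathbb F_q^a)\times\mathrm{GL}(\mathbb F_q^b))\ltimes\mathrm{Hom}(\mathbb F_q^b,\mathbb F_q^a)$ acting by $(g_0,g_1,T)(u_0+u_1)=(g_0u_0+Tg_1u_1)+g_1u_1$. A $G$-space $X$ and a $G'$-space $X'$ are called isomorphic as homogeneous spaces if there are a surjective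 homomorphism $\varphi\colon G\to G'$ and a bijection $e\colon X\to X'$ with $e(gx)=\varphi(g)e(x)$ for all $g\in G$, $x\in X$. **Proposition.** (1) For every $0\le\ell\le\min\{m-r,s\}$, as homogeneous spaces, $$H_{\Omega_\ell}/K_{\Omega_\ell}\;\cong\;\mathrm{GL}(\mathbb F_q^{r}\oplus\mathbb F_q^{m-\ell-r})/P_{r,m-\ell-r}\times\mathrm{GL}(\mathbb F_q^{s-\ell}\oplus\mathbb F_q^{n-m-s})/P_{s-\ell,n-m-s}\;\cong\;\mathcal G^q_{m-\ell,r}\times\mathcal G^q_{n-m-\ell,s-\ell},$$ where the products are acted upon by $\mathrm{GL}(\mathbb F_q^{m-\ell})\times\mathrm{GL}(\mathbb F_q^{n-m-\ell})$ (with $\mathbb F_q^{m-\ell}\cong\mathbb F_q^{r}\oplus\mathbb F_q^{m-\ell-r}$ and $\mathbb F_q^{n-m-\ell}\cong\mathbb F_q^{s-\ell}\oplus\mathbb F_q^{n-m-s}$). (2) The set $\{\theta_\ell:0\le\ell\le\min\{m-r,s\}\}$ is a complete set of representatives for the $K$-orbits on $\widehat B$. Moreover, for this and for any other complete set $\Theta$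 of representatives of the $K$-orbits on $\widehat B$, both conditions of the multiplicity-free criterion hold: (i) a subset $\Xi\subseteq\Theta$ has the property that $\{\xi\circ\pi:\xi\in\Xi\}$ is a complete set of representatives for the $H$-orbits on $\widehat A$ that contain a character inflated from $B$ if and only if $\Xi=\Theta$; (ii) for every $\theta\in\Theta$ the permutation representation of $H_\theta$ on the space $L(H_\theta/K_\theta)$ of complex functions on $H_\theta/K_\theta$ is multiplicity-free, that is, a direct sum of pairwise inequivalent irreducible representations. -/

import Mathlib

namespace QJohnson

/-! ### Homogeneous spaces, permutation representations, multiplicity-freeness -/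

/-- The product action of `G × G'` on `X × X'`. -/
instance prodAction {G G' X X' : Type*} [Monoid G] [Monoid G'] [MulAction G X] [MulAction G' X'] :
    MulAction (G × G') (X × X') where
  smul g x := (g.1 • x.1, g.2 • x.2)
  one_smul x := Prod.ext (one_smul G x.1) (one_smul G' x.2)
  mul_smul g h x := Prod.ext (mul_smul g.1 h.1 x.1) (mul_smul g.2 h.2 x.2)

/-- The `G`-space `X` and the `G'`-space `X'` are isomorphic as homogeneous spaces: the action of
`G` on `X` is carried to the action of `G'` on `X'` by a bijection `X ≃ X'` that is equivariant
along a surjective homomorphism `G → G'`. -/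
def IsoHomogeneous (G X G' X' : Type*) [Group G] [MulAction G X] [Group G'] [MulAction G' X'] :
    Prop :=
  ∃ (φ : G →* G') (e : X ≃ X'), Function.Surjective φ ∧ ∀ (g : G) (x : X), e (g • x) = φ g • e x

/-- The permutation representation of `G` on `L(X)`: `[g f](x) = f (g⁻¹ x)`. -/
def permRep (G X : Type*) [Group G] [MulAction G X] : Representation ℂ G (X → ℂ) where
  toFun g := LinearMap.funLeft ℂ ℂ (fun x : X => g⁻¹ • x)
  map_one' := by
    ext f x
    simp [LinearMap.funLeft_apply]
  map_mul' g h := by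
    refine LinearMap.ext fun f => funext fun x => ?_
    simp [LinearMap.funLeft_apply, mul_smul]

/-- A representation is multiplicity-free: it is the (finite) direct sum of pairwise inequivalent
irreducible subrepresentations. -/
def IsMultiplicityFree {G V : Type*} [Group G] [AddCommGroup V] [Module ℂ V]
    (ρ : Representation ℂ G V) : Prop :=
  ∃ (k : ℕ) (σ : Fin k → Subrepresentation ρ),
    (∀ i, (σ i).toRepresentation.IsIrreducible) ∧
    DirectSum.IsInternal (fun i => (σ i).toSubmodule) ∧
    ∀ i j, i ≠ j → IsEmpty ((σ i).toRepresentation.Equiv (σ j).toRepresentation)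

/-! ### Characters of abelian groups and the two conditions of the criterion -/

section Criterion

/-- The conjugate character `(ʰψ)(a) = ψ (h⁻¹ a)`. -/
def conjChar {G A : Type*} [Group G] [AddCommGroup A] [DistribMulAction G A]
    (g : G) (ψ : AddChar A ℂ) : AddChar A ℂ :=
  ψ.compAddMonoidHom (DistribSMul.toAddMonoidHom A g⁻¹)

variable {H A B : Type*} [Group H] [AddCommGroup A] [DistribMulAction H A] [AddCommGroup B]

/-- The inflation to `A` of a character `θ` of `B` along `π : A → B`. -/
def inflate (π : A →+ B) (θ : AddChar B ℂ) : AddChar A ℂ := θ.compAddMonoidHom π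

/-- The stabilizer in `G` of a character. -/
def charStabilizer (G : Type*) [Group G] [DistribMulAction G A] (ψ : AddChar A ℂ) :
    Subgroup G where
  carrier := {g | conjChar g ψ = ψ}
  one_mem' := by
    ext a
    simp [conjChar]
  mul_mem' {g h} hg hh := by
    ext a
    have h1 := DFunLike.congr_fun hg a
    have h2 := DFunLike.congr_fun hh (g⁻¹ • a)
    simp only [conjChar, AddChar.compAddMonoidHom_apply, DistribSMul.toAddMonoidHom_apply,
      mul_inv_rev, mul_smul] at h1 h2 ⊢
    rw [h2, h1]
  inv_mem' {g} hg := by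
    ext a
    have h1 := DFunLike.congr_fun hg (g • a)
    simp only [conjChar, AddChar.compAddMonoidHom_apply, DistribSMul.toAddMonoidHom_apply,
      inv_smul_smul, inv_inv] at h1 ⊢
    exact h1.symm

variable (K : Subgroup H) [DistribMulAction K B]

/-- `Θ` is a complete set of representatives for the orbits of `K` on the dual group of `B`. -/
def IsTheta (Θ : Set (AddChar B ℂ)) : Prop :=
  ∀ χ : AddChar B ℂ, ∃! θ, θ ∈ Θ ∧ ∃ k : K, conjChar k θ = χ

/-- `Ξ ⊆ Θ`, and the inflations of the elements of `Ξ` form a complete set of representatives for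
the `H`-orbits on the dual group of `A` that contain a character inflated from `B`. -/
def IsXi (H : Type*) [Group H] [DistribMulAction H A] (π : A →+ B)
    (Θ Ξ : Set (AddChar B ℂ)) : Prop :=
  Ξ ⊆ Θ ∧ ∀ ψ : AddChar A ℂ, (∃ (h : H) (θ : AddChar B ℂ), conjChar h ψ = inflate π θ) →
    ∃! ξ, ξ ∈ Ξ ∧ ∃ h : H, conjChar h (inflate π ξ) = ψ

/-- The two conditions of the criterion: `Ξ = Θ`, and for each `θ ∈ Θ` the permutation
representation of `H_θ` on `L(H_θ / K_θ)` is multiplicity-free, where `H_θ` is the stabilizer in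
`H` of the inflation of `θ` and `K_θ = H_θ ∩ K`. -/
structure CriterionHolds (π : A →+ B) (Θ : Set (AddChar B ℂ)) : Prop where
  xi_eq_theta : ∀ Ξ : Set (AddChar B ℂ), IsXi H π Θ Ξ ↔ Ξ = Θ
  multiplicityFree : ∀ θ ∈ Θ, IsMultiplicityFree
    (permRep (charStabilizer H (inflate π θ))
      (charStabilizer H (inflate π θ) ⧸ K.subgroupOf (charStabilizer H (inflate π θ))))

end Criterion

/-! ### Grassmannians -/

/-- The general linear group of a vector space. -/
abbrev GLin (F V : Type*) [Field F] [AddCommGroup V] [Module F V] : Type _ := V ≃ₗ[F] V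

/-- The Grassmannian of the `k`-dimensional subspaces of `V`. -/
def Gr (F V : Type*) [Field F] [AddCommGroup V] [Module F V] (k : ℕ) : Type _ :=
  {U : Submodule F V // Module.finrank F U = k}

instance {F V : Type*} [Field F] [AddCommGroup V] [Module F V] (k : ℕ) :
    MulAction (GLin F V) (Gr F V k) where
  smul g U := ⟨U.1.map (g : V →ₗ[F] V), by rw [LinearEquiv.finrank_map_eq g U.1]; exact U.2⟩
  one_smul U := Subtype.ext (Submodule.map_id U.1)
  mul_smul g h U := Subtype.ext (Submodule.map_comp (h : V →ₗ[F] V) (g : V →ₗ[F] V) U.1)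

/-! ### The groups `H`, `A` and the parabolic subgroups `H ⋉ A` of `GL(V₀ ⊕ V₁)` -/

section Spaces

variable (F V₀ V₁ : Type*) [Field F] [AddCommGroup V₀] [Module F V₀] [AddCommGroup V₁] [Module F V₁]

/-- `H = GL(V₀) × GL(V₁)`. -/
abbrev HGroup : Type _ := GLin F V₀ × GLin F V₁

/-- `A = Hom(V₁, V₀)`. -/
abbrev AGroup : Type _ := V₁ →ₗ[F] V₀

variable {F V₀ V₁}

/-- The action `(g₀, g₁) T = g₀ T g₁⁻¹` of `H` on `A`. -/
instance actionA : DistribMulAction (HGroup F V₀ V₁) (AGroup F V₀ V₁) where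
  smul h T := (h.1 : V₀ →ₗ[F] V₀) ∘ₗ T ∘ₗ ((h.2⁻¹ : GLin F V₁) : V₁ →ₗ[F] V₁)
  one_smul _ := rfl
  mul_smul _ _ _ := rfl
  smul_zero h := LinearMap.ext fun _ => map_zero h.1
  smul_add h _ _ := LinearMap.ext fun _ => map_add h.1 _ _

/-- The subgroup `H_S` of those `(g₀, g₁)` that fix `S : V₀ → V₁`, that is `g₁ S g₀⁻¹ = S`. -/
def stabHom (S : V₀ →ₗ[F] V₁) : Subgroup (HGroup F V₀ V₁) where
  carrier := {h | (h.2 : V₁ →ₗ[F] V₁) ∘ₗ S ∘ₗ ((h.1⁻¹ : GLin F V₀) : V₀ →ₗ[F] V₀) = S}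
  one_mem' := rfl
  mul_mem' {g h} hg hh := by
    refine LinearMap.ext fun v => ?_
    have h1 := LinearMap.congr_fun hg v
    have h2 := LinearMap.congr_fun hh (g.1⁻¹ v)
    exact (congrArg g.2 h2).trans h1
  inv_mem' {g} hg := by
    refine LinearMap.ext fun v => ?_
    have h1 := LinearMap.congr_fun hg (g.1 v)
    have h2 : g.2 (S v) = S (g.1 v) :=
      (congrArg (fun w => g.2 (S w)) (LinearEquiv.symm_apply_apply g.1 v).symm).trans h1
    exact (congrArg g.2.symm h2.symm).trans (LinearEquiv.symm_apply_apply g.2 (S v))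

variable (F V₀ V₁) in
/-- The semidirect product `H ⋉ A`, with product `(h, a)(h', a') = (h h', a + h a')`. -/
abbrev HA : Type _ :=
  Multiplicative (AGroup F V₀ V₁) ⋊[(MulAutMultiplicative (AGroup F V₀ V₁)).symm.toMonoidHom.comp
    (DistribMulAction.toAddAut (HGroup F V₀ V₁) (AGroup F V₀ V₁))] HGroup F V₀ V₁

/-- The automorphism `u₀ + u₁ ↦ (g₀ u₀ + T g₁ u₁) + g₁ u₁` of `V₀ ⊕ V₁`. -/
def HA.toGLFun (x : HA F V₀ V₁) : GLin F (V₀ × V₁) where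
  toFun u := (x.right.1 u.1 + x.left.toAdd (x.right.2 u.2), x.right.2 u.2)
  map_add' u v := by
    ext <;> simp
    abel
  map_smul' c u := by ext <;> simp
  invFun u := (x.right.1.symm (u.1 - x.left.toAdd u.2), x.right.2.symm u.2)
  left_inv u := by ext <;> simp
  right_inv u := by ext <;> simp

variable (F V₀ V₁) in
/-- The natural action of `H ⋉ A` on `V₀ ⊕ V₁`. -/
def HA.toGL : HA F V₀ V₁ →* GLin F (V₀ × V₁) where
  toFun := HA.toGLFun
  map_one' := by
    refine LinearEquiv.ext fun u => Prod.ext ?_ rfl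
    exact add_zero u.1
  map_mul' x y := by
    refine LinearEquiv.ext fun u => Prod.ext ?_ rfl
    change x.right.1 (y.right.1 u.1) + (x.left.toAdd (x.right.2 (y.right.2 u.2)) +
      x.right.1 (y.left.toAdd (x.right.2.symm (x.right.2 (y.right.2 u.2))))) =
      x.right.1 (y.right.1 u.1 + y.left.toAdd (y.right.2 u.2)) +
        x.left.toAdd (x.right.2 (y.right.2 u.2))
    rw [LinearEquiv.symm_apply_apply, map_add]
    abel

/-- `H_{a,b} ⋉ A_{b,a}` as a subgroup of the general linear group of `F^a ⊕ F^b`. -/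
def parabolic (F : Type*) [Field F] (a b : ℕ) : Subgroup (GLin F ((Fin a → F) × (Fin b → F))) :=
  (HA.toGL F (Fin a → F) (Fin b → F)).range

/-! ### The space `Y`, the groups `B_y`, the projections `π_y`, and the spaces `D_y` -/

variable (F V₀ V₁) in
/-- `Y_{r,s}`, with the componentwise action of `H`. -/
abbrev YSpace (r s : ℕ) : Type _ := Gr F V₀ r × Gr F V₁ s

variable {r s : ℕ}

/-- `B_y = Hom(U₁, V₀ / U₀)` for `y = (U₀, U₁)`. -/
abbrev BGroup (y : YSpace F V₀ V₁ r s) : Type _ := y.2.1 →ₗ[F] (V₀ ⧸ y.1.1)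

/-- The projection `π_y : A → B_y`, `T ↦ π_{U₀} T ι_{U₁}`. -/
def proj (y : YSpace F V₀ V₁ r s) : AGroup F V₀ V₁ →+ BGroup y where
  toFun T := y.1.1.mkQ ∘ₗ T ∘ₗ y.2.1.subtype
  map_zero' := LinearMap.ext fun _ => map_zero y.1.1.mkQ
  map_add' _ _ := LinearMap.ext fun _ => map_add y.1.1.mkQ _ _

/-- The stabilizer `K` of `y` in `H`. -/
abbrev KGroup (y : YSpace F V₀ V₁ r s) : Subgroup (HGroup F V₀ V₁) :=
  MulAction.stabilizer (HGroup F V₀ V₁) y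

theorem KGroup.mem₀ {y : YSpace F V₀ V₁ r s} (k : KGroup y) {v : V₀} (hv : v ∈ y.1.1) :
    k.1.1 v ∈ y.1.1 := by
  have h : y.1.1.map (k.1.1 : V₀ →ₗ[F] V₀) = y.1.1 :=
    congrArg (fun z : YSpace F V₀ V₁ r s => z.1.1) k.2
  have h' := Submodule.mem_map_of_mem (f := (k.1.1 : V₀ →ₗ[F] V₀)) hv
  rwa [h] at h'

theorem KGroup.mem₁ {y : YSpace F V₀ V₁ r s} (k : KGroup y) {v : V₁} (hv : v ∈ y.2.1) :
    k.1.2⁻¹ v ∈ y.2.1 := by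
  have h : y.2.1.map ((k⁻¹).1.2 : V₁ →ₗ[F] V₁) = y.2.1 :=
    congrArg (fun z : YSpace F V₀ V₁ r s => z.2.1) (k⁻¹).2
  have h' := Submodule.mem_map_of_mem (f := ((k⁻¹).1.2 : V₁ →ₗ[F] V₁)) hv
  rwa [h] at h'

/-- The action `(g₀, g₁) Ψ = g₀|_{V₀/U₀} Ψ g₁⁻¹|_{U₁}` of the stabilizer `K` of `y = (U₀, U₁)`
on `B_y`. -/
instance actionB (y : YSpace F V₀ V₁ r s) : DistribMulAction (KGroup y) (BGroup y) where
  smul k Ψ := (y.1.1.mapQ y.1.1 (k.1.1 : V₀ →ₗ[F] V₀) fun _ hv => KGroup.mem₀ k hv) ∘ₗ Ψ ∘ₗ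
    (((k.1.2⁻¹ : GLin F V₁) : V₁ →ₗ[F] V₁).restrict fun _ hv => KGroup.mem₁ k hv)
  one_smul Ψ := by
    refine LinearMap.ext fun v => ?_
    change y.1.1.mapQ y.1.1 LinearMap.id (fun _ hv => hv) (Ψ v) = Ψ v
    rw [Submodule.mapQ_id]
    rfl
  mul_smul k l Ψ := by
    refine LinearMap.ext fun v => ?_
    exact LinearMap.congr_fun (Submodule.mapQ_comp y.1.1 y.1.1 y.1.1 (l.1.1 : V₀ →ₗ[F] V₀)
      (k.1.1 : V₀ →ₗ[F] V₀) (fun _ hv => KGroup.mem₀ l hv) (fun _ hv => KGroup.mem₀ k hv)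
      fun _ hv => KGroup.mem₀ (k * l) hv) (Ψ _)
  smul_zero k := LinearMap.ext fun _ =>
    map_zero (y.1.1.mapQ y.1.1 (k.1.1 : V₀ →ₗ[F] V₀) fun _ hv => KGroup.mem₀ k hv)
  smul_add k _ _ := LinearMap.ext fun _ =>
    map_add (y.1.1.mapQ y.1.1 (k.1.1 : V₀ →ₗ[F] V₀) fun _ hv => KGroup.mem₀ k hv) _ _

/-- `D_y`: the linear maps `Ω : V₀ → V₁` with `U₀ ≤ ker Ω` and `im Ω ≤ U₁`, for `y = (U₀, U₁)`. -/
def DSpace (y : YSpace F V₀ V₁ r s) : Type _ :=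
  {Ω : V₀ →ₗ[F] V₁ // y.1.1 ≤ LinearMap.ker Ω ∧ LinearMap.range Ω ≤ y.2.1}

/-- The quotient operator `V₀ / U₀ → U₁`, `v + U₀ ↦ Ω v`, of `Ω ∈ D_y`. -/
def DSpace.quot {y : YSpace F V₀ V₁ r s} (Ω : DSpace y) : (V₀ ⧸ y.1.1) →ₗ[F] y.2.1 :=
  y.1.1.liftQ (Ω.1.codRestrict y.2.1 fun v => Ω.2.2 (LinearMap.mem_range_self Ω.1 v))
    fun _ hv => Subtype.ext (Ω.2.1 hv)

/-- The character `χ_Ω(Ψ) = τ(Tr[Ω_{U₀,U₁} Ψ])` of `B_y`, for `Ω ∈ D_y` and a character `τ` of the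
additive group of `F`. -/
noncomputable def DSpace.char (τ : AddChar F ℂ) {y : YSpace F V₀ V₁ r s} (Ω : DSpace y) :
    AddChar (BGroup y) ℂ :=
  τ.compAddMonoidHom
    ((LinearMap.trace F y.2.1).toAddMonoidHom.comp (LinearMap.compRight F Ω.quot).toAddMonoidHom)

end Spaces

end QJohnson

open QJohnson

/-!
The group `H_Ω` of pairs `(g₀, g₁)` with `g₁ Ω = Ω g₀` acts on `ker Ω` and on `coker Ω`, and maps onto
`GL(ker Ω) × GL(coker Ω)`: an automorphism of `ker Ω` extends by the identity on a complement, one of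
`coker Ω` lifts to an automorphism that is the identity on `im Ω`. Since `U₀ ≤ ker Ω` and
`im Ω ≤ U₁`, the pair `(U₀, U₁)` is the same as the point `(U₀, U₁ / im Ω)` of a product of
Grassmannians, on which the product of general linear groups is transitive. This is
`isoHomogeneous_stabHom`. A Grassmannian is the quotient of the general linear group by the parabolic
subgroup, which is the stabilizer of the first summand (`exists_quotient_parabolic_equiv`).

The trace pairing identifies the dual of `Hom(Y, X)` with `Hom(X, Y)` (`traceChar_bijective`): the
characters of `B` are the `χ_Ω` with `Ω ∈ D_y`, the inflation of `χ_Ω` is the character of `A` attached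
to `Ω`, and its stabilizer is `H_Ω`. The rank of `Ω` is invariant under `H`, and it already separates
the `K`-orbits because `K` maps onto `GL(V₀ / U₀) × GL(U₁)`. Hence two characters of `B` are
`K`-conjugate exactly when their inflations are `H`-conjugate (`exists_conjChar_iff_inflate`), which
gives the first condition of the criterion, and every rank up to `min (m - r) s` occurs once.

For the second condition, any two subspaces of the same dimension are swapped by an automorphism of
the ambient space (`Gr.exists_swap`), so any two points of `H_Ω / K_Ω` are swapped by `H_Ω`. The
matrices of the equivariant operators are then symmetric, the commutant is commutative, and the
permutation representation is multiplicity-free (`isMultiplicityFree_permRep`).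
-/

namespace QJohnson

/-! ### Multiplicity-free representations and Gelfand's trick -/

theorem commute_projection_of_invariant {V : Type*} [AddCommGroup V] [Module ℂ V]
    {p q : Submodule ℂ V} (h : IsCompl p q) (f : V →ₗ[ℂ] V) (hp : ∀ v ∈ p, f v ∈ p)
    (hq : ∀ v ∈ q, f v ∈ q) (v : V) : p.projection q h (f v) = f (p.projection q h v) := by
  have h1 := Submodule.projection_add_projection_eq_self h v
  conv_lhs => rw [← h1, map_add, map_add]
  rw [(Submodule.projection_apply_eq_zero_iff h).2 (hq _ (Submodule.projection_apply_mem h.symm v)),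
    add_zero]
  exact Submodule.projection_apply_left h ⟨_, hp _ (Submodule.projection_apply_mem h v)⟩

theorem isIrreducible_ofSubmodule {G V : Type*} [Group G] [AddCommGroup V] [Module ℂ V]
    {ρ : Representation ℂ G V} {N : Submodule (MonoidAlgebra ℂ G) ρ.asModule}
    (h : IsSimpleModule (MonoidAlgebra ℂ G) N) :
    (Subrepresentation.ofSubmodule' N).toRepresentation.IsIrreducible := by
  set σ := Subrepresentation.ofSubmodule' N
  have hatom : IsAtom σ := (OrderIso.isAtom_iff
    (Subrepresentation.subrepresentationSubmoduleOrderIso (ρ := ρ)).symm N).2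
    (isSimpleModule_iff_isAtom.1 h)
  refine { toNontrivial := ⟨⊥, ⊤, fun hbt => hatom.ne_bot ?_⟩, eq_bot_or_eq_top := fun τ => ?_ }
  · refine Subrepresentation.ext ((Submodule.eq_bot_iff _).2 fun x hx => ?_)
    have hx' : (⟨x, hx⟩ : σ.toSubmodule) ∈
        (⊥ : Subrepresentation σ.toRepresentation).toSubmodule := by
      rw [hbt]; exact Submodule.mem_top
    exact congrArg Subtype.val ((Submodule.mem_bot ℂ).1 hx')
  · let τ' : Subrepresentation ρ := ⟨τ.toSubmodule.map σ.toSubmodule.subtype, by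
      rintro g _ ⟨v, hv, rfl⟩
      exact ⟨_, τ.apply_mem_toSubmodule g hv, rfl⟩⟩
    have hle : τ' ≤ σ := by
      rintro _ ⟨v, -, rfl⟩
      exact v.2
    rcases hatom.le_iff.1 hle with h0 | h0
    · refine Or.inl (Subrepresentation.ext ((Submodule.eq_bot_iff _).2 fun x hx => ?_))
      have hx' : x.1 ∈ τ'.toSubmodule := ⟨x, hx, rfl⟩
      rw [h0] at hx'
      exact Subtype.ext ((Submodule.mem_bot ℂ).1 hx')
    · refine Or.inr (Subrepresentation.ext (Submodule.eq_top_iff'.2 fun x => ?_))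
      have hx' : x.1 ∈ τ'.toSubmodule := by rw [h0]; exact x.2
      obtain ⟨y, hy, hyx⟩ := hx'
      rwa [← Subtype.ext hyx]

/-- Maschke's theorem in the form of an internal decomposition. The decomposition is taken among the
`ℂ[G]`-submodules; being internal does not depend on the ring of scalars. -/
theorem exists_isInternal_isIrreducible {G V : Type*} [Group G] [Finite G] [AddCommGroup V]
    [Module ℂ V] [FiniteDimensional ℂ V] (ρ : Representation ℂ G V) :
    ∃ (k : ℕ) (σ : Fin k → Subrepresentation ρ), (∀ i, (σ i).toRepresentation.IsIrreducible) ∧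
      DirectSum.IsInternal (fun i => (σ i).toSubmodule) := by
  have hss : IsSemisimpleModule (MonoidAlgebra ℂ G) ρ.asModule :=
    (Representation.isSemisimpleRepresentation_iff_isSemisimpleModule_asModule ρ).1 inferInstance
  have hfin : Module.Finite (MonoidAlgebra ℂ G) ρ.asModule :=
    Module.Finite.of_restrictScalars_finite ℂ _ _
  obtain ⟨s, hind, hsup, hsimple⟩ :=
    IsSemisimpleModule.exists_sSupIndep_sSup_simples_eq_top (MonoidAlgebra ℂ G) ρ.asModule
  rw [sSupIndep_iff] at hind
  have : Finite s := WellFoundedGT.finite_of_iSupIndep hind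
    fun S => (isSimpleModule_iff_isAtom.1 (hsimple S S.2)).ne_bot
  obtain ⟨k, ⟨e⟩⟩ := Finite.exists_equiv_fin s
  let N : Fin k → Submodule (MonoidAlgebra ℂ G) ρ.asModule := fun i => (e.symm i).1
  have hN : DirectSum.IsInternal N := by
    refine DirectSum.isInternal_submodule_of_iSupIndep_of_iSup_eq_top
      (hind.comp e.symm.injective) ?_
    rw [← hsup, sSup_eq_iSup']
    exact e.symm.iSup_comp (g := fun S : s => S.1)
  exact ⟨k, fun i => Subrepresentation.ofSubmodule' (N i), fun i =>
    isIrreducible_ofSubmodule (hsimple _ (e.symm i).2), hN⟩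

/-- Two equivalent summands `σ i` and `σ j` would give the endomorphism `σ i ≅ σ j` extended by zero,
which does not commute with the projection onto `σ i`. -/
theorem isMultiplicityFree_of_commute {G V : Type*} [Group G] [Finite G] [AddCommGroup V]
    [Module ℂ V] [FiniteDimensional ℂ V] (ρ : Representation ℂ G V)
    (hcomm : ∀ S T : V →ₗ[ℂ] V, (∀ g v, S (ρ g v) = ρ g (S v)) → (∀ g v, T (ρ g v) = ρ g (T v)) →
      ∀ v, S (T v) = T (S v)) : IsMultiplicityFree ρ := by
  obtain ⟨k, σ, hirr, hint⟩ := exists_isInternal_isIrreducible ρ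
  refine ⟨k, σ, hirr, hint, fun i j hij => ⟨fun f => ?_⟩⟩
  set p := (σ i).toSubmodule
  set q := ⨆ l ≠ i, (σ l).toSubmodule
  have hc : IsCompl p q := ⟨hint.submodule_iSupIndep i, codisjoint_iff.2 <| top_unique <| by
    rw [← hint.submodule_iSup_eq_top]
    refine iSup_le fun l => ?_
    by_cases hl : l = i
    · rw [hl]; exact le_sup_left
    · exact le_sup_of_le_right (le_iSup₂_of_le l hl le_rfl)⟩
  have hqinv : ∀ g, ∀ v ∈ q, ρ g v ∈ q := by
    intro g
    change q ≤ q.comap (ρ g)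
    refine iSup₂_le fun l hl v hv => ?_
    exact Submodule.mem_iSup_of_mem l (Submodule.mem_iSup_of_mem hl
      ((σ l).apply_mem_toSubmodule g hv))
  have hS : ∀ g v, p.projection q hc (ρ g v) = ρ g (p.projection q hc v) := fun g v =>
    commute_projection_of_invariant hc (ρ g) (fun _ hv => (σ i).apply_mem_toSubmodule g hv)
      (hqinv g) v
  let T : V →ₗ[ℂ] V := (σ j).toSubmodule.subtype ∘ₗ f.toLinearMap ∘ₗ p.projectionOnto q hc
  have hT : ∀ g v, T (ρ g v) = ρ g (T v) := by
    intro g v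
    have h1 : p.projectionOnto q hc (ρ g v) =
        (σ i).toRepresentation g (p.projectionOnto q hc v) := Subtype.ext (hS g v)
    have h2 := f.toIntertwiningMap.isIntertwining _ _ g (p.projectionOnto q hc v)
    change ((f (p.projectionOnto q hc (ρ g v)) : (σ j).toSubmodule) : V) = _
    rw [h1]
    exact congrArg Subtype.val h2
  -- The projection onto `σ i` fixes `x` and kills `T x = f x`, which lies in `σ j`.
  have hz : ∀ x : p, x = 0 := by
    intro x
    have h1 := hcomm _ T hS hT x
    have hmem : T x ∈ q := Submodule.mem_iSup_of_mem j
      (Submodule.mem_iSup_of_mem hij.symm (f (p.projectionOnto q hc x)).2)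
    rw [(Submodule.projection_apply_eq_zero_iff hc).2 hmem] at h1
    have h3 : f x = 0 := by
      apply Subtype.ext
      have : T (p.projection q hc x) = f x := by simp [T]
      rw [← this, ← h1]; rfl
    exact f.toLinearEquiv.map_eq_zero_iff.1 h3
  refine (hirr i).bot_ne_top (Subrepresentation.ext ?_)
  ext x
  rw [hz x]
  simp

/-- The matrix of an equivariant operator is constant on the orbits of `G` on `X × X`; if every pair
of points can be swapped by `G`, the matrix is therefore symmetric. -/
theorem apply_single_symm_of_equivariant {G X : Type*} [Group G] [MulAction G X] [DecidableEq X]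
    (hsymm : ∀ x y : X, ∃ g : G, g • x = y ∧ g • y = x) {S : (X → ℂ) →ₗ[ℂ] (X → ℂ)}
    (hS : ∀ g v, S (permRep G X g v) = permRep G X g (S v)) (x y : X) :
    S (Pi.single y 1) x = S (Pi.single x 1) y := by
  obtain ⟨g, hxy, hyx⟩ := hsymm x y
  have h1 : permRep G X g (Pi.single y 1) = Pi.single x 1 := by
    funext z
    change (Pi.single y (1 : ℂ) : X → ℂ) (g⁻¹ • z) = _
    simp only [Pi.single_apply, inv_smul_eq_iff, hyx]
  rw [← h1, hS]
  change _ = S (Pi.single y 1) (g⁻¹ • y)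
  rw [← hxy, inv_smul_smul]

/-- Gelfand's trick: if any two points of `X` are swapped by an element of `G`, then products of
equivariant operators are symmetric matrices, so that `ST = (ST)ᵀ = TᵀSᵀ = TS`. -/
theorem isMultiplicityFree_permRep {G X : Type*} [Group G] [Finite G] [Finite X] [MulAction G X]
    (hsymm : ∀ x y : X, ∃ g : G, g • x = y ∧ g • y = x) : IsMultiplicityFree (permRep G X) := by
  classical
  cases nonempty_fintype X
  refine isMultiplicityFree_of_commute _ fun S T hS hT v => ?_
  have key : LinearMap.toMatrix' (S ∘ₗ T) = LinearMap.toMatrix' (T ∘ₗ S) := by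
    have hsym : ∀ R : (X → ℂ) →ₗ[ℂ] (X → ℂ),
        (∀ g v, R (permRep G X g v) = permRep G X g (R v)) →
        (LinearMap.toMatrix' R).transpose = LinearMap.toMatrix' R := fun R hR => by
      ext x y
      simpa [LinearMap.toMatrix'_apply] using apply_single_symm_of_equivariant hsymm hR y x
    rw [← hsym (S ∘ₗ T) fun g v => by simp [hS, hT], LinearMap.toMatrix'_comp,
      Matrix.transpose_mul, hsym S hS, hsym T hT, LinearMap.toMatrix'_comp]
  exact LinearMap.congr_fun (LinearMap.toMatrix'.injective key) v

/-! ### Homogeneous spaces -/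

/-- The orbit map of `x₀` along a surjection `φ : G → G'`, as an equivariant bijection from the
quotient by the preimage of the stabilizer of `x₀`. -/
theorem exists_quotient_equiv {G G' X' : Type*} [Group G] [Group G'] [MulAction G' X']
    (φ : G →* G') (hφ : Function.Surjective φ) (htrans : ∀ x y : X', ∃ g : G', g • x = y)
    (x₀ : X') (S : Subgroup G) (hS : ∀ g, g ∈ S ↔ φ g • x₀ = x₀) :
    ∃ e : (G ⧸ S) ≃ X', ∀ (g : G) (x : G ⧸ S), e (g • x) = φ g • e x := by
  have hrel : ∀ a b : G, a⁻¹ * b ∈ S ↔ φ a • x₀ = φ b • x₀ := fun a b => by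
    rw [hS, map_mul, map_inv, mul_smul, inv_smul_eq_iff, eq_comm]
  let f : G ⧸ S → X' := Quotient.lift (fun g => φ g • x₀) fun a b hab =>
    (hrel a b).1 (QuotientGroup.leftRel_apply.1 hab)
  refine ⟨Equiv.ofBijective f ⟨?_, fun y => ?_⟩, ?_⟩
  · rintro ⟨a⟩ ⟨b⟩ hab
    exact QuotientGroup.eq.2 ((hrel a b).2 hab)
  · obtain ⟨g', rfl⟩ := htrans x₀ y
    obtain ⟨g, rfl⟩ := hφ g'
    exact ⟨(g : G ⧸ S), rfl⟩
  · rintro g ⟨a⟩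
    change φ (g * a) • x₀ = φ g • φ a • x₀
    rw [map_mul, mul_smul]

theorem IsoHomogeneous.exists_swap {G X G' X' : Type*} [Group G] [MulAction G X] [Group G']
    [MulAction G' X'] (h : IsoHomogeneous G X G' X')
    (hsymm : ∀ x y : X', ∃ g : G', g • x = y ∧ g • y = x) (x y : X) :
    ∃ g : G, g • x = y ∧ g • y = x := by
  obtain ⟨φ, e, hφ, he⟩ := h
  obtain ⟨g', h1, h2⟩ := hsymm (e x) (e y)
  obtain ⟨g, rfl⟩ := hφ g'
  exact ⟨g, e.injective ((he g x).trans h1), e.injective ((he g y).trans h2)⟩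

/-! ### Extending and lifting automorphisms; the action on Grassmannians -/

section LinearAlgebra

variable {F V W : Type*} [Field F] [AddCommGroup V] [Module F V] [AddCommGroup W] [Module F W]

/-- An automorphism of the kernel of `S` extends by the identity on a complement, which leaves `S`
unchanged. -/
theorem exists_extend_ker (S : V →ₗ[F] W) (a : GLin F (LinearMap.ker S)) :
    ∃ g : GLin F V, (∀ v : LinearMap.ker S, g v = a v) ∧ ∀ v, S (g v) = S v := by
  obtain ⟨C, hC⟩ := Submodule.exists_isCompl (LinearMap.ker S)
  let e := Submodule.prodEquivOfIsCompl _ C hC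
  refine ⟨e.symm ≪≫ₗ LinearEquiv.prodCongr a (LinearEquiv.refl F C) ≪≫ₗ e, fun v => ?_, fun v => ?_⟩
  · simp [e]
  · obtain ⟨x, rfl⟩ := e.surjective v
    simp [e]

/-- An automorphism of `V ⧸ U` lifts to one of `V` that is the identity on `U`. -/
theorem exists_lift_quotient (U : Submodule F V) (b : GLin F (V ⧸ U)) :
    ∃ g : GLin F V, (∀ u ∈ U, g u = u) ∧ ∀ v, U.mkQ (g v) = b (U.mkQ v) := by
  obtain ⟨C, hC⟩ := Submodule.exists_isCompl U
  let e := Submodule.prodEquivOfIsCompl _ C hC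
  let q := Submodule.quotientEquivOfIsCompl U C hC
  refine ⟨e.symm ≪≫ₗ LinearEquiv.prodCongr (LinearEquiv.refl F U) (q.symm ≪≫ₗ b ≪≫ₗ q) ≪≫ₗ e,
    fun u hu => ?_, fun v => ?_⟩
  · have : e.symm u = (⟨u, hu⟩, 0) := Submodule.prodEquivOfIsCompl_symm_apply_left U C hC ⟨u, hu⟩
    simp [this, e]
  · obtain ⟨⟨x, y⟩, rfl⟩ := e.surjective v
    have h0 : U.mkQ x = 0 := (Submodule.Quotient.mk_eq_zero U).2 x.2
    simp only [LinearEquiv.trans_apply, LinearEquiv.symm_apply_apply, LinearEquiv.prodCongr_apply]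
    simp only [e, Submodule.coe_prodEquivOfIsCompl', map_add, LinearEquiv.refl_apply, h0, zero_add]
    exact Submodule.mk_quotientEquivOfIsCompl_apply hC _

variable [FiniteDimensional F V]

/-- Rank classifies linear maps up to automorphisms of source and target. -/
theorem exists_equivalent_of_finrank_range_eq [FiniteDimensional F W] {S S' : V →ₗ[F] W}
    (h : Module.finrank F (LinearMap.range S) = Module.finrank F (LinearMap.range S')) :
    ∃ (a : GLin F V) (b : GLin F W), ∀ v, b (S v) = S' (a v) := by
  obtain ⟨C, hC⟩ := Submodule.exists_isCompl (LinearMap.ker S)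
  obtain ⟨C', hC'⟩ := Submodule.exists_isCompl (LinearMap.ker S')
  let e := LinearEquiv.ofFinrankEq _ _ h
  obtain ⟨b, hb⟩ := Submodule.exists_linearEquiv_restrict_eq e
  have hk : Module.finrank F (LinearMap.ker S) = Module.finrank F (LinearMap.ker S') := by
    have h1 := S.finrank_range_add_finrank_ker
    have h2 := S'.finrank_range_add_finrank_ker
    omega
  let κ := LinearEquiv.ofFinrankEq _ _ hk
  let c := S.kerComplementEquivRange hC.symm
  let c' := S'.kerComplementEquivRange hC'.symm
  let p := Submodule.prodEquivOfIsCompl _ C hC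
  let p' := Submodule.prodEquivOfIsCompl _ C' hC'
  refine ⟨p.symm ≪≫ₗ LinearEquiv.prodCongr κ (c ≪≫ₗ e ≪≫ₗ c'.symm) ≪≫ₗ p', b, fun v => ?_⟩
  obtain ⟨⟨x, y⟩, rfl⟩ := p.surjective v
  have h1 : S (p (x, y)) = c y := by simp [p, c]
  have h2 : ∀ z w, S' (p' (z, w)) = c' w := fun z w => by simp [p', c']
  rw [h1, ← hb]
  simp [h2]

/-- The general linear group acts on the Grassmannian in such a way that any two points can be
swapped: exchange complements of `U ⊓ W` in `U` and in `W`, and fix `U ⊓ W`. -/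
theorem Gr.exists_swap {k : ℕ} (U W : Gr F V k) : ∃ g : GLin F V, g • U = W ∧ g • W = U := by
  obtain ⟨U, hU⟩ := U
  obtain ⟨W, hW⟩ := W
  obtain ⟨U', hdU, hsU⟩ := IsModularLattice.exists_disjoint_and_sup_eq (inf_le_left : U ⊓ W ≤ U)
  obtain ⟨W', hdW, hsW⟩ := IsModularLattice.exists_disjoint_and_sup_eq (inf_le_right : U ⊓ W ≤ W)
  have hU'U : U' ≤ U := hsU ▸ le_sup_right
  have hW'W : W' ≤ W := hsW ▸ le_sup_right
  have hfin : Module.finrank F U' = Module.finrank F W' := by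
    have h1 := Submodule.finrank_sup_add_finrank_inf_eq (U ⊓ W) U'
    have h2 := Submodule.finrank_sup_add_finrank_inf_eq (U ⊓ W) W'
    rw [hsU, hdU.eq_bot, finrank_bot] at h1
    rw [hsW, hdW.eq_bot, finrank_bot] at h2
    omega
  let ε := LinearEquiv.ofFinrankEq _ _ hfin
  -- `φ` identifies `(U ⊓ W) × U' × W'` with `U ⊔ W`; the swap `σ` there is extended to `V`.
  let φ : (↥(U ⊓ W) × (U' × W')) →ₗ[F] V :=
    (U ⊓ W).subtype.coprod (U'.subtype.coprod W'.subtype)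
  have hφ : Function.Injective φ := by
    rw [← LinearMap.ker_eq_bot, LinearMap.ker_eq_bot']
    rintro ⟨⟨i, hi⟩, ⟨u, hu⟩, ⟨w, hw⟩⟩ h
    have h : i + (u + w) = 0 := h
    have hwU : w ∈ U := by
      have : w = -(i + u) := by rw [eq_neg_iff_add_eq_zero, ← h]; abel
      rw [this]
      exact U.neg_mem (U.add_mem hi.1 (hU'U hu))
    have hw0 : w = 0 := Submodule.disjoint_def.1 hdW w ⟨hwU, hW'W hw⟩ hw
    rw [hw0, add_zero] at h
    have huI : u ∈ U ⊓ W := by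
      rw [eq_neg_of_add_eq_zero_right h]
      exact (U ⊓ W).neg_mem hi
    have hu0 : u = 0 := Submodule.disjoint_def.1 hdU u huI hu
    rw [hu0, add_zero] at h
    simp [hw0, hu0, h]
  let σ : (↥(U ⊓ W) × (U' × W')) ≃ₗ[F] (↥(U ⊓ W) × (U' × W')) :=
    LinearEquiv.prodCongr (LinearEquiv.refl F _)
      (LinearEquiv.prodComm F U' W' ≪≫ₗ LinearEquiv.prodCongr ε.symm ε)
  let f := LinearEquiv.ofInjective φ hφ
  obtain ⟨g, hg⟩ := Submodule.exists_linearEquiv_restrict_eq (f.symm ≪≫ₗ σ ≪≫ₗ f)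
  have hgφ : ∀ (i : ↥(U ⊓ W)) (u : U') (w : W'),
      g (i.1 + (u.1 + w.1)) = i.1 + ((ε.symm w).1 + (ε u).1) := fun i u w => by
    have h1 := hg (f (i, u, w))
    simp only [LinearEquiv.trans_apply, LinearEquiv.symm_apply_apply] at h1
    exact h1.symm
  have hgU : U.map (g : V →ₗ[F] V) ≤ W := by
    rintro _ ⟨x, hx, rfl⟩
    rw [← hsU] at hx
    obtain ⟨i, hi, u, hu, rfl⟩ := Submodule.mem_sup.1 hx
    have h1 := hgφ ⟨i, hi⟩ ⟨u, hu⟩ 0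
    simp only [map_zero, Submodule.coe_zero, add_zero, zero_add] at h1
    rw [LinearEquiv.coe_coe, h1]
    exact W.add_mem hi.2 (hW'W (ε _).2)
  have hgW : W.map (g : V →ₗ[F] V) ≤ U := by
    rintro _ ⟨x, hx, rfl⟩
    rw [← hsW] at hx
    obtain ⟨i, hi, u, hu, rfl⟩ := Submodule.mem_sup.1 hx
    have h1 := hgφ ⟨i, hi⟩ 0 ⟨u, hu⟩
    simp only [map_zero, Submodule.coe_zero, add_zero, zero_add] at h1
    rw [LinearEquiv.coe_coe, h1]
    exact U.add_mem hi.1 (hU'U (ε.symm _).2)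
  refine ⟨g, Subtype.ext (Submodule.eq_of_le_of_finrank_eq hgU ?_),
    Subtype.ext (Submodule.eq_of_le_of_finrank_eq hgW ?_)⟩
  · exact (LinearEquiv.finrank_map_eq g U).trans (hU.trans hW.symm)
  · exact (LinearEquiv.finrank_map_eq g W).trans (hW.trans hU.symm)

end LinearAlgebra

/-! ### Parabolic subgroups -/

/-- The parabolic subgroup is the stabilizer of the first summand. -/
theorem mem_parabolic_iff {F : Type*} [Field F] {a b : ℕ}
    (g : GLin F ((Fin a → F) × (Fin b → F))) :
    g ∈ parabolic F a b ↔ ∀ u, (g (u, 0)).2 = 0 := by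
  constructor
  · rintro ⟨x, rfl⟩ u
    exact map_zero x.right.2
  · intro h
    have h₀ : ∀ u, g (u, 0) = ((g (u, 0)).1, 0) := fun u => Prod.ext rfl (h u)
    let g₀ : (Fin a → F) →ₗ[F] (Fin a → F) := LinearMap.fst F _ _ ∘ₗ g.toLinearMap ∘ₗ
      LinearMap.inl F _ _
    let g₁ : (Fin b → F) →ₗ[F] (Fin b → F) := LinearMap.snd F _ _ ∘ₗ g.toLinearMap ∘ₗ
      LinearMap.inr F _ _
    have hg₀ : Function.Injective g₀ := fun u v huv => by
      have : g (u, 0) = g (v, 0) := by rw [h₀ u, h₀ v]; exact Prod.ext huv rfl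
      exact congrArg Prod.fst (g.injective this)
    have hsplit : ∀ u w, g (u, w) = g (u, 0) + g (0, w) := fun u w => by
      rw [← map_add]; simp
    have hg₁ : Function.Surjective g₁ := fun w => by
      obtain ⟨⟨u, w'⟩, hw⟩ := g.surjective (0, w)
      refine ⟨w', ?_⟩
      rw [hsplit, h₀] at hw
      exact (zero_add _).symm.trans (congrArg Prod.snd hw)
    let e₀ := LinearEquiv.ofInjectiveEndo g₀ hg₀
    let e₁ := LinearEquiv.ofInjectiveEndo g₁ (LinearMap.injective_iff_surjective.2 hg₁)
    let T : (Fin b → F) →ₗ[F] (Fin a → F) := LinearMap.fst F _ _ ∘ₗ g.toLinearMap ∘ₗ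
      LinearMap.inr F _ _ ∘ₗ e₁.symm.toLinearMap
    refine ⟨⟨Multiplicative.ofAdd T, (e₀, e₁)⟩, LinearEquiv.ext fun x => ?_⟩
    obtain ⟨u, w⟩ := x
    rw [hsplit, h₀]
    change ((g (u, 0)).1 + (g (0, e₁.symm (e₁ w))).1, (g (0, w)).2) = _
    rw [LinearEquiv.symm_apply_apply]
    refine Prod.ext rfl ?_
    simp

/-- The isomorphism of general linear groups induced by a linear equivalence `e`, `g ↦ e g e⁻¹`. -/
def glinCongr {F E E' : Type*} [Field F] [AddCommGroup E] [Module F E] [AddCommGroup E']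
    [Module F E'] (e : E ≃ₗ[F] E') : GLin F E ≃* GLin F E' where
  toFun g := e.symm ≪≫ₗ g ≪≫ₗ e
  invFun g := e ≪≫ₗ g ≪≫ₗ e.symm
  left_inv g := by ext; simp
  right_inv g := by ext; simp
  map_mul' g h := by ext; simp

/-- The quotient by the parabolic subgroup is the Grassmannian, as the orbit of the image of the first
summand. -/
theorem exists_quotient_parabolic_equiv {F E : Type*} [Field F] [AddCommGroup E] [Module F E]
    [FiniteDimensional F E] {a b : ℕ} (e : ((Fin a → F) × (Fin b → F)) ≃ₗ[F] E) :
    ∃ ε : (GLin F ((Fin a → F) × (Fin b → F)) ⧸ parabolic F a b) ≃ Gr F E a,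
      ∀ g x, ε (g • x) = glinCongr e g • ε x := by
  let j : (Fin a → F) →ₗ[F] E := e.toLinearMap ∘ₗ LinearMap.inl F _ _
  have hj : Function.Injective j := e.injective.comp LinearMap.inl_injective
  let P : Gr F E a := ⟨LinearMap.range j, by simp [LinearMap.finrank_range_of_inj hj]⟩
  refine exists_quotient_equiv (glinCongr e).toMonoidHom (glinCongr e).surjective
    (fun U W => (Gr.exists_swap U W).imp fun _ h => h.1) P _ fun g => ?_
  rw [mem_parabolic_iff]
  have hmem : ∀ x, e x ∈ LinearMap.range j ↔ x.2 = 0 := fun x => by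
    constructor
    · rintro ⟨u, hu⟩
      rw [← e.injective hu]
      rfl
    · exact fun hx => ⟨x.1, congrArg e (Prod.ext rfl hx.symm)⟩
  constructor
  · intro h
    refine Subtype.ext (Submodule.eq_of_le_of_finrank_eq ?_ (LinearEquiv.finrank_map_eq _ _))
    rintro _ ⟨_, ⟨u, rfl⟩, rfl⟩
    change e (g (e.symm (e (u, 0)))) ∈ _
    rw [LinearEquiv.symm_apply_apply]
    exact (hmem _).2 (h u)
  · intro h u
    have h1 : e (g (e.symm (e (u, 0)))) ∈ (glinCongr e g • P).1 := ⟨_, ⟨u, rfl⟩, rfl⟩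
    rw [LinearEquiv.symm_apply_apply] at h1
    refine (hmem _).1 ?_
    have h2 : glinCongr e g • P = P := h
    rwa [h2] at h1

/-- The homomorphism is an isomorphism of groups here, so that the equivariant bijection can be
inverted. -/
theorem exists_quotient_parabolic_prod_equiv {F E₀ E₁ : Type*} [Field F] [AddCommGroup E₀]
    [Module F E₀] [FiniteDimensional F E₀] [AddCommGroup E₁] [Module F E₁] [FiniteDimensional F E₁]
    {a b c d : ℕ} (h₀ : Module.finrank F E₀ = a + b) (h₁ : Module.finrank F E₁ = c + d) :
    ∃ (φ : (GLin F ((Fin a → F) × (Fin b → F)) × GLin F ((Fin c → F) × (Fin d → F))) ≃*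
        (GLin F E₀ × GLin F E₁))
      (e : ((GLin F ((Fin a → F) × (Fin b → F)) ⧸ parabolic F a b) ×
        (GLin F ((Fin c → F) × (Fin d → F)) ⧸ parabolic F c d)) ≃ (Gr F E₀ a × Gr F E₁ c)),
      ∀ g x, e (g • x) = φ g • e x := by
  obtain ⟨ε₀, hε₀⟩ := exists_quotient_parabolic_equiv (F := F) (a := a) (b := b)
    (LinearEquiv.ofFinrankEq _ E₀ (by simp [h₀]))
  obtain ⟨ε₁, hε₁⟩ := exists_quotient_parabolic_equiv (F := F) (a := c) (b := d)
    (LinearEquiv.ofFinrankEq _ E₁ (by simp [h₁]))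
  exact ⟨MulEquiv.prodCongr (glinCongr _) (glinCongr _), ε₀.prodCongr ε₁,
    fun g x => Prod.ext (hε₀ g.1 x.1) (hε₁ g.2 x.2)⟩

/-! ### The stabilizer of a linear map -/

section

variable {F V₀ V₁ : Type*} [Field F] [AddCommGroup V₀] [Module F V₀] [AddCommGroup V₁] [Module F V₁]

theorem mem_stabHom_iff {S : V₀ →ₗ[F] V₁} {h : HGroup F V₀ V₁} :
    h ∈ stabHom S ↔ ∀ v, h.2 (S v) = S (h.1 v) := by
  constructor
  · intro hh v
    have h1 : h.2 (S (h.1.symm (h.1 v))) = S (h.1 v) := LinearMap.congr_fun hh (h.1 v)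
    rwa [LinearEquiv.symm_apply_apply] at h1
  · refine fun hh => LinearMap.ext fun v => ?_
    change h.2 (S (h.1.symm v)) = S v
    rw [hh, LinearEquiv.apply_symm_apply]

theorem map_ker_eq_of_mem_stabHom {S : V₀ →ₗ[F] V₁} (h : stabHom S) :
    (LinearMap.ker S).map (h.1.1 : V₀ →ₗ[F] V₀) = LinearMap.ker S := by
  ext v
  obtain ⟨w, rfl⟩ := h.1.1.surjective v
  have h1 := mem_stabHom_iff.1 h.2 w
  rw [LinearMap.mem_ker, ← h1, LinearEquiv.map_eq_zero_iff]
  constructor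
  · rintro ⟨u, hu, huw⟩
    rwa [← h.1.1.injective huw]
  · exact fun hw => ⟨w, hw, rfl⟩

theorem map_range_eq_of_mem_stabHom {S : V₀ →ₗ[F] V₁} (h : stabHom S) :
    (LinearMap.range S).map (h.1.2 : V₁ →ₗ[F] V₁) = LinearMap.range S := by
  ext v
  constructor
  · rintro ⟨_, ⟨u, rfl⟩, rfl⟩
    exact ⟨h.1.1 u, (mem_stabHom_iff.1 h.2 u).symm⟩
  · rintro ⟨u, rfl⟩
    refine ⟨S (h.1.1.symm u), ⟨_, rfl⟩, ?_⟩
    exact (mem_stabHom_iff.1 h.2 _).trans (by rw [LinearEquiv.apply_symm_apply])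

/-- The restriction `(g₀, g₁) ↦ g₀|_{ker S}` of the stabilizer of `S` to the kernel. -/
def kerHom (S : V₀ →ₗ[F] V₁) : stabHom S →* GLin F (LinearMap.ker S) :=
  MonoidHom.mk' (fun h => h.1.1.ofSubmodules _ _ (map_ker_eq_of_mem_stabHom h)) fun _ _ => rfl

/-- The homomorphism that sends `(g₀, g₁)` in the stabilizer of `S` to the automorphism of
`V₁ / im S` induced by `g₁`. -/
def cokerHom (S : V₀ →ₗ[F] V₁) : stabHom S →* GLin F (V₁ ⧸ LinearMap.range S) :=
  MonoidHom.mk' (fun h => Submodule.Quotient.equiv _ _ h.1.2 (map_range_eq_of_mem_stabHom h))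
    fun g h => by
      ext v
      obtain ⟨v, rfl⟩ := Submodule.mkQ_surjective _ v
      rfl

theorem exists_kerHom_cokerHom_eq (S : V₀ →ₗ[F] V₁) (a : GLin F (LinearMap.ker S))
    (b : GLin F (V₁ ⧸ LinearMap.range S)) : ∃ h, kerHom S h = a ∧ cokerHom S h = b := by
  obtain ⟨g₀, hg₀, hS⟩ := exists_extend_ker S a
  obtain ⟨g₁, hg₁, hb⟩ := exists_lift_quotient _ b
  refine ⟨⟨(g₀, g₁), mem_stabHom_iff.2 fun v => ?_⟩, ?_, ?_⟩
  · exact (hg₁ _ ⟨v, rfl⟩).trans (hS v).symm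
  · ext v
    exact hg₀ v
  · ext v
    obtain ⟨v, rfl⟩ := Submodule.mkQ_surjective _ v
    exact hb v

variable [FiniteDimensional F V₀] [FiniteDimensional F V₁] {r s : ℕ} {y : YSpace F V₀ V₁ r s}

theorem mem_KGroup_iff {h : HGroup F V₀ V₁} :
    h ∈ KGroup y ↔ (∀ v ∈ y.1.1, h.1 v ∈ y.1.1) ∧ ∀ v ∈ y.2.1, h.2 v ∈ y.2.1 := by
  constructor
  · intro hh
    refine ⟨fun v hv => KGroup.mem₀ ⟨h, hh⟩ hv, fun v hv => ?_⟩
    have := KGroup.mem₁ (⟨h, hh⟩⁻¹ : KGroup y) hv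
    exact this
  · rintro ⟨h0, h1⟩
    refine Prod.ext (Subtype.ext (Submodule.eq_of_le_of_finrank_eq ?_
      (LinearEquiv.finrank_map_eq _ _))) (Subtype.ext (Submodule.eq_of_le_of_finrank_eq ?_
      (LinearEquiv.finrank_map_eq _ _)))
    · rintro _ ⟨v, hv, rfl⟩
      exact h0 v hv
    · rintro _ ⟨v, hv, rfl⟩
      exact h1 v hv

theorem Gr.smul_eq_iff {E : Type*} [AddCommGroup E] [Module F E] [FiniteDimensional F E] {k : ℕ}
    {g : GLin F E} {U : Gr F E k} : g • U = U ↔ ∀ v ∈ U.1, g v ∈ U.1 := by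
  constructor
  · intro h v hv
    have h1 : g v ∈ (g • U).1 := ⟨v, hv, rfl⟩
    rwa [h] at h1
  · refine fun h => Subtype.ext (Submodule.eq_of_le_of_finrank_eq ?_
      (LinearEquiv.finrank_map_eq _ _))
    rintro _ ⟨v, hv, rfl⟩
    exact h v hv

/-- The stabilizer of `Ω` maps onto `GL(ker Ω) × GL(coker Ω)`, and the elements that also stabilize
`(U₀, U₁)` are those whose images stabilize `U₀ ≤ ker Ω` and `U₁ / im Ω ≤ coker Ω`. -/
theorem isoHomogeneous_stabHom (Ω : DSpace y) {E₀ E₁ : Type*} [AddCommGroup E₀] [Module F E₀]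
    [AddCommGroup E₁] [Module F E₁] (e₀ : LinearMap.ker Ω.1 ≃ₗ[F] E₀)
    (e₁ : (V₁ ⧸ LinearMap.range Ω.1) ≃ₗ[F] E₁) {k : ℕ}
    (hk : k = s - Module.finrank F (LinearMap.range Ω.1)) :
    IsoHomogeneous (stabHom Ω.1) (stabHom Ω.1 ⧸ (KGroup y).subgroupOf (stabHom Ω.1))
      (GLin F E₀ × GLin F E₁) (Gr F E₀ r × Gr F E₁ k) := by
  have := e₀.finiteDimensional
  have := e₁.finiteDimensional
  let φ : stabHom Ω.1 →* GLin F E₀ × GLin F E₁ :=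
    ((glinCongr e₀).toMonoidHom.comp (kerHom Ω.1)).prod
      ((glinCongr e₁).toMonoidHom.comp (cokerHom Ω.1))
  have hφ : Function.Surjective φ := by
    rintro ⟨a, b⟩
    obtain ⟨h, h0, h1⟩ := exists_kerHom_cokerHom_eq Ω.1 ((glinCongr e₀).symm a)
      ((glinCongr e₁).symm b)
    refine ⟨h, Prod.ext ?_ ?_⟩
    · change glinCongr e₀ (kerHom Ω.1 h) = a
      rw [h0, MulEquiv.apply_symm_apply]
    · change glinCongr e₁ (cokerHom Ω.1 h) = b
      rw [h1, MulEquiv.apply_symm_apply]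
  -- The base point is `(U₀, U₁ / im Ω)`; its dimensions are `r` and `s - rank Ω`.
  let U₀ : Gr F E₀ r := ⟨(y.1.1.comap (LinearMap.ker Ω.1).subtype).map (e₀ : _ →ₗ[F] E₀), by
    rw [LinearEquiv.finrank_map_eq, (Submodule.comapSubtypeEquivOfLe Ω.2.1).finrank_eq, y.1.2]⟩
  let U₁ : Gr F E₁ k := ⟨(y.2.1.map (LinearMap.range Ω.1).mkQ).map (e₁ : _ →ₗ[F] E₁), by
    rw [LinearEquiv.finrank_map_eq]
    have h1 := ((LinearMap.range Ω.1).mkQ ∘ₗ y.2.1.subtype).finrank_range_add_finrank_ker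
    rw [LinearMap.range_comp, Submodule.range_subtype, LinearMap.ker_comp, Submodule.ker_mkQ,
      (Submodule.comapSubtypeEquivOfLe Ω.2.2).finrank_eq, y.2.2] at h1
    omega⟩
  obtain ⟨e, he⟩ := exists_quotient_equiv φ hφ (fun x z : Gr F E₀ r × Gr F E₁ k => by
      obtain ⟨g₀, h₀, -⟩ := Gr.exists_swap x.1 z.1
      obtain ⟨g₁, h₁, -⟩ := Gr.exists_swap x.2 z.2
      exact ⟨(g₀, g₁), Prod.ext h₀ h₁⟩) (U₀, U₁) ((KGroup y).subgroupOf (stabHom Ω.1)) fun h => by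
    have h0 : glinCongr e₀ (kerHom Ω.1 h) • U₀ = U₀ ↔ ∀ v ∈ y.1.1, h.1.1 v ∈ y.1.1 := by
      rw [Gr.smul_eq_iff]
      constructor
      · intro H v hv
        obtain ⟨w, hw, hwv⟩ := H _ ⟨⟨v, Ω.2.1 hv⟩, hv, rfl⟩
        have h2 : e₀ w = e₀ (kerHom Ω.1 h (e₀.symm (e₀ ⟨v, Ω.2.1 hv⟩))) := hwv
        rw [LinearEquiv.symm_apply_apply] at h2
        rw [e₀.injective h2] at hw
        exact hw
      · rintro H _ ⟨v, hv, rfl⟩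
        refine ⟨kerHom Ω.1 h v, H _ hv, ?_⟩
        change _ = e₀ (kerHom Ω.1 h (e₀.symm (e₀ v)))
        rw [LinearEquiv.symm_apply_apply]
        rfl
    have h1 : glinCongr e₁ (cokerHom Ω.1 h) • U₁ = U₁ ↔ ∀ v ∈ y.2.1, h.1.2 v ∈ y.2.1 := by
      rw [Gr.smul_eq_iff]
      constructor
      · intro H v hv
        obtain ⟨w, ⟨w, hw, rfl⟩, hwv⟩ := H _ ⟨_, ⟨v, hv, rfl⟩, rfl⟩
        have h2 : e₁ _ = e₁ (cokerHom Ω.1 h (e₁.symm (e₁ _))) := hwv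
        rw [LinearEquiv.symm_apply_apply] at h2
        have h3 : h.1.2 v - w ∈ LinearMap.range Ω.1 :=
          (Submodule.Quotient.eq _).1 (e₁.injective h2).symm
        simpa using y.2.1.add_mem (Ω.2.2 h3) hw
      · rintro H _ ⟨_, ⟨v, hv, rfl⟩, rfl⟩
        refine ⟨_, ⟨_, H _ hv, rfl⟩, ?_⟩
        change _ = e₁ (cokerHom Ω.1 h (e₁.symm (e₁ _)))
        rw [LinearEquiv.symm_apply_apply]
        rfl
    rw [Subgroup.mem_subgroupOf, mem_KGroup_iff, ← h0, ← h1]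
    exact (Prod.ext_iff (x := φ h • (U₀, U₁)) (y := (U₀, U₁))).symm
  exact ⟨φ, e, hφ, he⟩

end

/-! ### Characters and the trace pairing -/

theorem conjChar_mul {G A : Type*} [Group G] [AddCommGroup A] [DistribMulAction G A] (g h : G)
    (ψ : AddChar A ℂ) : conjChar (g * h) ψ = conjChar g (conjChar h ψ) := by
  ext a
  simp [conjChar, mul_smul]

theorem conjChar_inv_eq_iff {G A : Type*} [Group G] [AddCommGroup A] [DistribMulAction G A] {g : G}
    {ψ χ : AddChar A ℂ} : conjChar g⁻¹ ψ = χ ↔ conjChar g χ = ψ := by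
  have h1 : ∀ ψ : AddChar A ℂ, conjChar (1 : G) ψ = ψ := fun ψ => by ext a; simp [conjChar]
  constructor
  · rintro rfl
    rw [← conjChar_mul, mul_inv_cancel, h1]
  · rintro rfl
    rw [← conjChar_mul, inv_mul_cancel, h1]

section TraceCharacters

variable {F X Y : Type*} [Field F] [AddCommGroup X] [Module F X] [AddCommGroup Y] [Module F Y]

/-- The character `Ψ ↦ τ(Tr[S Ψ])` of `Hom(Y, X)`, for `S : X → Y`. The character `χ_Ω` of `B_y` is
`traceChar τ Ω.quot` by definition. -/
noncomputable def traceChar (τ : AddChar F ℂ) (S : X →ₗ[F] Y) : AddChar (Y →ₗ[F] X) ℂ :=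
  τ.compAddMonoidHom ((LinearMap.trace F Y).toAddMonoidHom.comp
    (LinearMap.compRight F S).toAddMonoidHom)

theorem traceChar_apply (τ : AddChar F ℂ) (S : X →ₗ[F] Y) (Ψ : Y →ₗ[F] X) :
    traceChar τ S Ψ = τ (LinearMap.trace F Y (S ∘ₗ Ψ)) := rfl

variable [FiniteDimensional F Y] {τ : AddChar F ℂ}

/-- Nondegeneracy of the trace pairing, tested on maps of rank one. -/
theorem traceChar_injective (hτ : τ ≠ 1) :
    Function.Injective (traceChar τ : (X →ₗ[F] Y) → AddChar (Y →ₗ[F] X) ℂ) := by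
  intro S S' h
  obtain ⟨c, hc⟩ := AddChar.ne_one_iff.1 hτ
  by_contra hne
  obtain ⟨x, hx⟩ : ∃ x, S x ≠ S' x := by
    by_contra! hall
    exact hne (LinearMap.ext hall)
  obtain ⟨f, hf⟩ := Module.Projective.exists_dual_eq_one F (sub_ne_zero.2 hx)
  -- The rank-one map `v ↦ c f(v) x`, composed with `S - S'`, has trace `c f(S x - S' x) = c`.
  have happly : ∀ R : X →ₗ[F] Y, traceChar τ R ((c • f).smulRight x) = τ (c * f (R x)) := by
    intro R
    have h1 : R ∘ₗ (c • f).smulRight x = (c • f).smulRight (R x) := LinearMap.ext fun v => by simp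
    rw [traceChar_apply, h1, LinearMap.trace_smulRight]
    rfl
  have h1 := DFunLike.congr_fun h ((c • f).smulRight x)
  rw [happly, happly] at h1
  refine hc ?_
  have h2 : c = c * f (S x) - c * f (S' x) := by rw [← mul_sub, ← map_sub, hf, mul_one]
  rw [h2, AddChar.map_sub_eq_div, h1, div_self (τ.val_isUnit _).ne_zero]

/-- The trace pairing identifies `Hom(X, Y)` with the dual group of `Hom(Y, X)`. -/
theorem traceChar_bijective [Finite F] [FiniteDimensional F X] (hτ : τ ≠ 1) :
    Function.Bijective (traceChar τ : (X →ₗ[F] Y) → AddChar (Y →ₗ[F] X) ℂ) := by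
  have : Finite X := Module.finite_of_finite F
  have : Finite Y := Module.finite_of_finite F
  have h1 : Finite (X →ₗ[F] Y) := Module.finite_of_finite F
  have h2 : Finite (Y →ₗ[F] X) := Module.finite_of_finite F
  cases nonempty_fintype (X →ₗ[F] Y)
  cases nonempty_fintype (Y →ₗ[F] X)
  refine (Fintype.bijective_iff_injective_and_card _).2 ⟨traceChar_injective hτ, ?_⟩
  rw [AddChar.card_eq, ← Nat.card_eq_fintype_card, ← Nat.card_eq_fintype_card]
  refine Nat.card_congr (LinearEquiv.ofFinrankEq (R := F) _ _ ?_).toEquiv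
  rw [Module.finrank_linearMap, Module.finrank_linearMap, mul_comm]

end TraceCharacters

section

variable {F V₀ V₁ : Type*} [Field F] [AddCommGroup V₀] [Module F V₀] [AddCommGroup V₁] [Module F V₁]
  {r s : ℕ} {y : YSpace F V₀ V₁ r s} {τ : AddChar F ℂ}

theorem DSpace.finrank_range_quot (Ω : DSpace y) :
    Module.finrank F (LinearMap.range Ω.quot) = Module.finrank F (LinearMap.range Ω.1) := by
  have h1 : Ω.1 = y.2.1.subtype ∘ₗ Ω.quot ∘ₗ y.1.1.mkQ := rfl
  conv_rhs => rw [h1, LinearMap.range_comp, LinearMap.range_comp, Submodule.range_mkQ,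
    Submodule.map_top]
  exact (Submodule.finrank_map_subtype_eq _ _).symm

theorem inflate_conjChar (k : KGroup y) (θ : AddChar (BGroup y) ℂ) :
    inflate (proj y) (conjChar k θ) = conjChar k.1 (inflate (proj y) θ) := rfl

variable [FiniteDimensional F V₁]

theorem conjChar_traceChar (h : HGroup F V₀ V₁) (S : V₀ →ₗ[F] V₁) :
    conjChar h (traceChar τ S : AddChar (AGroup F V₀ V₁) ℂ) =
      traceChar τ ((h.2 : V₁ →ₗ[F] V₁) ∘ₗ S ∘ₗ ((h.1⁻¹ : GLin F V₀) : V₀ →ₗ[F] V₀)) := by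
  ext T
  refine congrArg τ ?_
  exact LinearMap.trace_comp_comm' (S ∘ₗ ((h.1⁻¹ : GLin F V₀) : V₀ →ₗ[F] V₀) ∘ₗ T)
    (h.2 : V₁ →ₗ[F] V₁) |>.symm

/-- Since the trace is cyclic, the inflation of the character `χ_Ω` of `B_y` is the character of `A`
attached to `Ω : V₀ → V₁` itself. -/
theorem inflate_char (Ω : DSpace y) : inflate (proj y) (Ω.char τ) = traceChar τ Ω.1 := by
  ext T
  refine congrArg τ ?_
  exact LinearMap.trace_comp_comm' (Ω.quot ∘ₗ y.1.1.mkQ ∘ₗ T) y.2.1.subtype |>.symm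

theorem charStabilizer_traceChar (hτ : τ ≠ 1) (S : V₀ →ₗ[F] V₁) :
    charStabilizer (HGroup F V₀ V₁) (traceChar τ S : AddChar (AGroup F V₀ V₁) ℂ) = stabHom S := by
  ext h
  change conjChar h _ = _ ↔ _
  rw [conjChar_traceChar, (traceChar_injective hτ).eq_iff]
  rfl

/-- The rank is an invariant of the `H`-orbit of the inflated character. -/
theorem finrank_range_eq_of_conjChar_inflate (hτ : τ ≠ 1) {Ω Ω' : DSpace y}
    {h : HGroup F V₀ V₁}
    (hh : conjChar h (inflate (proj y) (Ω.char τ)) = inflate (proj y) (Ω'.char τ)) :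
    Module.finrank F (LinearMap.range Ω.1) = Module.finrank F (LinearMap.range Ω'.1) := by
  rw [inflate_char, inflate_char, conjChar_traceChar] at hh
  rw [← traceChar_injective hτ hh, LinearMap.range_comp, LinearMap.range_comp, LinearEquiv.range,
    Submodule.map_top, LinearEquiv.finrank_map_eq]

variable [FiniteDimensional F V₀]

/-- Every character of `B_y` is some `χ_Ω`, because every linear map `V₀ / U₀ → U₁` is induced by an
element of `D_y`. -/
theorem exists_char_eq [Finite F] (hτ : τ ≠ 1) (θ : AddChar (BGroup y) ℂ) :
    ∃ Ω : DSpace y, θ = Ω.char τ := by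
  obtain ⟨S, rfl⟩ := (traceChar_bijective hτ).2 θ
  refine ⟨⟨y.2.1.subtype ∘ₗ S ∘ₗ y.1.1.mkQ, fun v hv => ?_, ?_⟩, congrArg (traceChar τ) ?_⟩
  · have : y.1.1.mkQ v = 0 := (Submodule.Quotient.mk_eq_zero _).2 hv
    simp only [LinearMap.mem_ker, LinearMap.comp_apply, this, map_zero]
  · rintro _ ⟨v, rfl⟩
    exact (S _).2
  · ext v
    rfl

theorem DSpace.finrank_range_le (Ω : DSpace y) : Module.finrank F (LinearMap.range Ω.1) ≤
    min (Module.finrank F V₀ - r) s := by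
  rw [← Ω.finrank_range_quot]
  refine le_min ?_ ?_
  · have h1 := Submodule.finrank_quotient_add_finrank y.1.1
    have h2 := LinearMap.finrank_range_le Ω.quot
    rw [y.1.2] at h1
    omega
  · exact (Submodule.finrank_le _).trans y.2.2.le

/-- The map `Ω ↦ χ_Ω` from `D_y` is onto, and the inflation of `χ_Ω` determines `Ω`. -/
theorem inflate_injective [Finite F] (hτ : τ ≠ 1) :
    Function.Injective (inflate (proj y) : AddChar (BGroup y) ℂ → _) := fun θ θ' h => by
  obtain ⟨Ω, rfl⟩ := exists_char_eq hτ θ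
  obtain ⟨Ω', rfl⟩ := exists_char_eq hτ θ'
  rw [inflate_char, inflate_char] at h
  exact congrArg _ (Subtype.ext (traceChar_injective hτ h))

/-- The rank of `Ω` determines the `K`-orbit of `χ_Ω`, since `K` maps onto
`GL(V₀ / U₀) × GL(U₁)`. -/
theorem exists_conjChar_char_eq [Finite F] (hτ : τ ≠ 1) {Ω Ω' : DSpace y}
    (h : Module.finrank F (LinearMap.range Ω.1) = Module.finrank F (LinearMap.range Ω'.1)) :
    ∃ k : KGroup y, conjChar k (Ω.char τ) = Ω'.char τ := by
  rw [← Ω.finrank_range_quot, ← Ω'.finrank_range_quot] at h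
  obtain ⟨a, b, hab⟩ := exists_equivalent_of_finrank_range_eq h
  obtain ⟨g₀, hg₀, ha⟩ := exists_lift_quotient _ a
  obtain ⟨g₁, hb⟩ := Submodule.exists_linearEquiv_restrict_eq b
  have hk : ((g₀, g₁) : HGroup F V₀ V₁) ∈ KGroup y := mem_KGroup_iff.2
    ⟨fun v hv => by rwa [hg₀ v hv], fun v hv => by
      change g₁ (⟨v, hv⟩ : y.2.1) ∈ _
      rw [← hb]
      exact (b _).2⟩
  refine ⟨⟨_, hk⟩, inflate_injective hτ ?_⟩
  rw [inflate_conjChar, inflate_char, inflate_char, conjChar_traceChar]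
  refine congrArg _ (LinearMap.ext fun v => ?_)
  obtain ⟨v, rfl⟩ := g₀.surjective v
  change g₁ (Ω.quot (y.1.1.mkQ (g₀.symm (g₀ v)))) = Ω'.quot (y.1.1.mkQ (g₀ v))
  rw [LinearEquiv.symm_apply_apply, ← hb, hab, ha]

/-- Two characters of `B_y` lie in one `K`-orbit exactly when their inflations lie in one `H`-orbit,
because either condition says that the ranks agree. -/
theorem exists_conjChar_iff_inflate [Finite F] (hτ : τ ≠ 1) (θ θ' : AddChar (BGroup y) ℂ) :
    (∃ k : KGroup y, conjChar k θ = θ') ↔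
      ∃ h : HGroup F V₀ V₁, conjChar h (inflate (proj y) θ) = inflate (proj y) θ' := by
  constructor
  · rintro ⟨k, rfl⟩
    exact ⟨k.1, rfl⟩
  · rintro ⟨h, hh⟩
    obtain ⟨Ω, rfl⟩ := exists_char_eq hτ θ
    obtain ⟨Ω', rfl⟩ := exists_char_eq hτ θ'
    exact exists_conjChar_char_eq hτ (finrank_range_eq_of_conjChar_inflate hτ hh)

theorem isXi_iff_eq [Finite F] (hτ : τ ≠ 1) {Θ : Set (AddChar (BGroup y) ℂ)}
    (hΘ : IsTheta (KGroup y) Θ) (Ξ : Set (AddChar (BGroup y) ℂ)) :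
    IsXi (HGroup F V₀ V₁) (proj y) Θ Ξ ↔ Ξ = Θ := by
  constructor
  · rintro ⟨hsub, hΞ⟩
    refine hsub.antisymm fun θ hθ => ?_
    have h1 : conjChar (1 : HGroup F V₀ V₁) (inflate (proj y) θ) = inflate (proj y) θ := by
      ext a; simp [conjChar]
    obtain ⟨ξ, ⟨hξ, hh⟩, -⟩ := hΞ (inflate (proj y) θ) ⟨1, θ, h1⟩
    obtain ⟨θ', -, huniq⟩ := hΘ θ
    rw [huniq θ ⟨hθ, (exists_conjChar_iff_inflate hτ θ θ).2 ⟨1, h1⟩⟩,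
      ← huniq ξ ⟨hsub hξ, (exists_conjChar_iff_inflate hτ ξ θ).2 hh⟩]
    exact hξ
  · rintro rfl
    refine ⟨subset_rfl, ?_⟩
    rintro ψ ⟨h, θ, hθ⟩
    have hψ := conjChar_inv_eq_iff.2 hθ
    obtain ⟨ξ, ⟨hξ, k, hk⟩, huniq⟩ := hΘ θ
    refine ⟨ξ, ⟨hξ, h⁻¹ * k.1, ?_⟩, ?_⟩
    · rw [conjChar_mul, ← inflate_conjChar, hk, hψ]
    · rintro ξ' ⟨hξ', h', hh'⟩
      refine huniq ξ' ⟨hξ', (exists_conjChar_iff_inflate hτ ξ' θ).2 ⟨h * h', ?_⟩⟩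
      rw [conjChar_mul, hh', hθ]

theorem finite_GLin {F V : Type*} [Field F] [Finite F] [AddCommGroup V] [Module F V]
    [FiniteDimensional F V] : Finite (GLin F V) := by
  have : Finite V := Module.finite_of_finite F
  exact Finite.of_injective (fun g : GLin F V => (g : V → V)) DFunLike.coe_injective

theorem isMultiplicityFree_stabHom [Finite F] (Ω : DSpace y) :
    IsMultiplicityFree (permRep (stabHom Ω.1)
      (stabHom Ω.1 ⧸ (KGroup y).subgroupOf (stabHom Ω.1))) := by
  have := finite_GLin (F := F) (V := V₀)
  have := finite_GLin (F := F) (V := V₁)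
  refine isMultiplicityFree_permRep (IsoHomogeneous.exists_swap (isoHomogeneous_stabHom Ω
    (LinearEquiv.refl F _) (LinearEquiv.refl F _) rfl) fun x z => ?_)
  obtain ⟨g₀, h₀, h₀'⟩ := Gr.exists_swap x.1 z.1
  obtain ⟨g₁, h₁, h₁'⟩ := Gr.exists_swap x.2 z.2
  exact ⟨(g₀, g₁), Prod.ext h₀ h₁, Prod.ext h₀' h₁'⟩

theorem criterionHolds_of_isTheta [Finite F] (hτ : τ ≠ 1) {Θ : Set (AddChar (BGroup y) ℂ)}
    (hΘ : IsTheta (KGroup y) Θ) : CriterionHolds (KGroup y) (proj y) Θ where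
  xi_eq_theta := isXi_iff_eq hτ hΘ
  multiplicityFree θ _ := by
    obtain ⟨Ω, rfl⟩ := exists_char_eq hτ θ
    have h : charStabilizer (HGroup F V₀ V₁) (inflate (proj y) (Ω.char τ)) = stabHom Ω.1 := by
      rw [inflate_char, charStabilizer_traceChar hτ]
    rw [h]
    exact isMultiplicityFree_stabHom Ω

theorem isTheta_char [Finite F] (hτ : τ ≠ 1) {N : ℕ} (hN : N = min (Module.finrank F V₀ - r) s)
    (Ω : ℕ → DSpace y) (hΩ : ∀ ℓ ≤ N, Module.finrank F (LinearMap.range (Ω ℓ).1) = ℓ) :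
    IsTheta (KGroup y) {θ | ∃ ℓ ≤ N, θ = (Ω ℓ).char τ} := by
  intro χ
  obtain ⟨Ω', rfl⟩ := exists_char_eq hτ χ
  have hle := hN ▸ Ω'.finrank_range_le
  refine ⟨_, ⟨⟨_, hle, rfl⟩, exists_conjChar_char_eq hτ (hΩ _ hle)⟩, ?_⟩
  rintro _ ⟨⟨ℓ, hℓ, rfl⟩, k, hk⟩
  have h1 : conjChar k.1 (inflate (proj y) ((Ω ℓ).char τ)) = inflate (proj y) (Ω'.char τ) := by
    rw [← inflate_conjChar, hk]
  rw [← finrank_range_eq_of_conjChar_inflate hτ h1, hΩ ℓ hℓ]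

end

end QJohnson

theorem mainTheorem11 {F V₀ V₁ : Type*} [Field F] [Finite F]
    [AddCommGroup V₀] [Module F V₀] [FiniteDimensional F V₀]
    [AddCommGroup V₁] [Module F V₁] [FiniteDimensional F V₁]
    (m n r s : ℕ) (hmn : m ≤ n)
    (hV₀ : Module.finrank F V₀ = m) (hV₁ : Module.finrank F V₁ = n - m)
    (y₀ : YSpace F V₀ V₁ r s)
    (τ : AddChar F ℂ) (hτ : τ ≠ 1)
    (Ω : ℕ → DSpace y₀)
    (hΩ : ∀ ℓ ≤ min (m - r) s, Module.finrank F (LinearMap.range (Ω ℓ).1) = ℓ) :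
    -- (1)
    (∀ ℓ ≤ min (m - r) s,
      IsoHomogeneous
        (stabHom (Ω ℓ).1)
        (stabHom (Ω ℓ).1 ⧸ (KGroup y₀).subgroupOf (stabHom (Ω ℓ).1))
        (GLin F ((Fin r → F) × (Fin (m - ℓ - r) → F)) ×
          GLin F ((Fin (s - ℓ) → F) × (Fin (n - m - s) → F)))
        ((GLin F ((Fin r → F) × (Fin (m - ℓ - r) → F)) ⧸ parabolic F r (m - ℓ - r)) ×
          (GLin F ((Fin (s - ℓ) → F) × (Fin (n - m - s) → F)) ⧸ parabolic F (s - ℓ) (n - m - s))) ∧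
      IsoHomogeneous
        (GLin F ((Fin r → F) × (Fin (m - ℓ - r) → F)) ×
          GLin F ((Fin (s - ℓ) → F) × (Fin (n - m - s) → F)))
        ((GLin F ((Fin r → F) × (Fin (m - ℓ - r) → F)) ⧸ parabolic F r (m - ℓ - r)) ×
          (GLin F ((Fin (s - ℓ) → F) × (Fin (n - m - s) → F)) ⧸ parabolic F (s - ℓ) (n - m - s)))
        (GLin F (Fin (m - ℓ) → F) × GLin F (Fin (n - m - ℓ) → F))
        (Gr F (Fin (m - ℓ) → F) r × Gr F (Fin (n - m - ℓ) → F) (s - ℓ)) ∧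
      IsoHomogeneous
        (stabHom (Ω ℓ).1)
        (stabHom (Ω ℓ).1 ⧸ (KGroup y₀).subgroupOf (stabHom (Ω ℓ).1))
        (GLin F (Fin (m - ℓ) → F) × GLin F (Fin (n - m - ℓ) → F))
        (Gr F (Fin (m - ℓ) → F) r × Gr F (Fin (n - m - ℓ) → F) (s - ℓ))) ∧
    -- (2)
    IsTheta (KGroup y₀) {θ | ∃ ℓ ≤ min (m - r) s, θ = (Ω ℓ).char τ} ∧
    ∀ Θ : Set (AddChar (BGroup y₀) ℂ), IsTheta (KGroup y₀) Θ →
      CriterionHolds (KGroup y₀) (proj y₀) Θ := by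
  refine ⟨fun ℓ hℓ => ?_, isTheta_char hτ (by rw [hV₀]) Ω hΩ,
    fun Θ hΘ => criterionHolds_of_isTheta hτ hΘ⟩
  have hrank := hΩ ℓ hℓ
  have hr : r ≤ m := by rw [← hV₀, ← y₀.1.2]; exact Submodule.finrank_le _
  have hs : s ≤ n - m := by rw [← hV₁, ← y₀.2.2]; exact Submodule.finrank_le _
  have hker := (Ω ℓ).1.finrank_range_add_finrank_ker
  have hcoker := Submodule.finrank_quotient_add_finrank (LinearMap.range (Ω ℓ).1)
  have h3 : IsoHomogeneous (stabHom (Ω ℓ).1)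
      (stabHom (Ω ℓ).1 ⧸ (KGroup y₀).subgroupOf (stabHom (Ω ℓ).1))
      (GLin F (Fin (m - ℓ) → F) × GLin F (Fin (n - m - ℓ) → F))
      (Gr F (Fin (m - ℓ) → F) r × Gr F (Fin (n - m - ℓ) → F) (s - ℓ)) :=
    isoHomogeneous_stabHom (Ω ℓ)
      (LinearEquiv.ofFinrankEq _ _ (by rw [Module.finrank_fin_fun]; omega))
      (LinearEquiv.ofFinrankEq _ _ (by rw [Module.finrank_fin_fun]; omega)) (by rw [hrank])
  obtain ⟨φ, e, he⟩ := exists_quotient_parabolic_prod_equiv (F := F) (E₀ := Fin (m - ℓ) → F)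
    (E₁ := Fin (n - m - ℓ) → F) (a := r) (b := m - ℓ - r) (c := s - ℓ) (d := n - m - s)
    (by rw [Module.finrank_fin_fun]; omega) (by rw [Module.finrank_fin_fun]; omega)
  refine ⟨?_, ⟨φ.toMonoidHom, e, φ.surjective, he⟩, h3⟩
  obtain ⟨φ', e', hφ', he'⟩ := h3
  refine ⟨φ.symm.toMonoidHom.comp φ', e'.trans e.symm, φ.symm.surjective.comp hφ', fun g x => ?_⟩
  apply e.injective
  change e (e.symm (e' (g • x))) = e (φ.symm (φ' g) • e.symm (e' x))
  rw [he, Equiv.apply_symm_apply, Equiv.apply_symm_apply, MulEquiv.apply_symm_apply, he']
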